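/- Let $H$ be a separable complex Hilbert space and let $\mathcal{S}_1=\mathcal{S}_1(H)$ be the Schatten space of all bounded operators $A$ on $H$ with $\|A\|_1=\operatorname{Tr}|A|<\infty$, where $|A|=(A^*A)^{1/2}$, normed by $\|\cdot\|_1$. Let $Z$ be a complex Banach space and let $T:\mathcal{S}_1\to Z$ be a bounded linear operator. Then $T$ is Dunford–Pettis (that is, $T$ maps every weakly compact subset of $\mathcal{S}_1$ to a relatively norm compact subset of $Z$) if and only if for every subspace $E\subset\mathcal{S}_1$ that is isomorphic, as a topological vector space, to $\ell_2$, the restriction $T|_E$ is a compact operator. -/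

import Mathlib

noncomputable section

open scoped InnerProductSpace ENNReal

set_option linter.unusedSectionVars false

namespace SchattenOne

variable {H : Type*} [NormedAddCommGroup H] [InnerProductSpace ℂ H] [CompleteSpace H]

/-- The trace `∑ᵢ ⟪P bᵢ, bᵢ⟫ ∈ [0, ∞]` of a positive operator `P`, computed in the Hilbert basis `b`.
(For positive `P` it does not depend on `b`: `traceIn_eq_traceIn`.) -/
def traceIn {ι : Type*} (b : HilbertBasis ι ℂ H) (P : H →L[ℂ] H) : ℝ≥0∞ :=
  ∑' i, ENNReal.ofReal (RCLike.re ⟪P (b i), b i⟫_ℂ)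

/-- Squared Hilbert-Schmidt norm, computed in the basis `b`. -/
def hsSq {ι : Type*} (b : HilbertBasis ι ℂ H) (S : H →L[ℂ] H) : ℝ≥0∞ :=
  ∑' i, ENNReal.ofReal (‖S (b i)‖ ^ 2)

theorem tsum_ofReal_norm_inner_sq {ι : Type*} (b : HilbertBasis ι ℂ H) (x : H) :
    ∑' i, ENNReal.ofReal (‖⟪b i, x⟫_ℂ‖ ^ 2) = ENNReal.ofReal (‖x‖ ^ 2) := by
  have h := b.hasSum_inner_mul_inner x x
  have h2 : HasSum (fun i => ‖⟪b i, x⟫_ℂ‖ ^ 2) (‖x‖ ^ 2) := by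
    have h3 := (RCLike.reCLM (K := ℂ)).hasSum h
    have e1 : RCLike.reCLM (K := ℂ) ⟪x, x⟫_ℂ = ‖x‖ ^ 2 := by
      simpa using (norm_sq_eq_re_inner (𝕜 := ℂ) x).symm
    rw [e1] at h3
    have e2 : (fun i => ‖⟪b i, x⟫_ℂ‖ ^ 2)
        = fun i => RCLike.reCLM (K := ℂ) (⟪x, b i⟫_ℂ * ⟪b i, x⟫_ℂ) := by
      funext i
      rw [← inner_conj_symm x (b i), RCLike.conj_mul]
      simp only [RCLike.reCLM_apply]
      norm_cast
    rw [e2]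
    exact h3
  rw [← h2.tsum_eq, ENNReal.ofReal_tsum_of_nonneg (fun i => by positivity) h2.summable]

theorem hsSq_adjoint {ι κ : Type*} (b : HilbertBasis ι ℂ H) (c : HilbertBasis κ ℂ H)
    (S : H →L[ℂ] H) : hsSq b S = hsSq c (ContinuousLinearMap.adjoint S) := by
  unfold hsSq
  simp_rw [← tsum_ofReal_norm_inner_sq c (S _),
    ← tsum_ofReal_norm_inner_sq b (ContinuousLinearMap.adjoint S _)]
  rw [ENNReal.tsum_comm]
  refine tsum_congr fun j => tsum_congr fun i => ?_
  rw [ContinuousLinearMap.adjoint_inner_right, norm_inner_symm]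

theorem hsSq_comp_le {ι : Type*} (b : HilbertBasis ι ℂ H) (W S : H →L[ℂ] H) (hW : ‖W‖ ≤ 1) :
    hsSq b (W * S) ≤ hsSq b S := by
  refine ENNReal.tsum_le_tsum fun i => ENNReal.ofReal_le_ofReal ?_
  have : ‖W (S (b i))‖ ≤ ‖S (b i)‖ := by
    simpa using W.le_of_opNorm_le hW (S (b i))
  simpa using pow_le_pow_left₀ (norm_nonneg _) this 2

theorem sqrt_apply_inner {P : H →L[ℂ] H} (hP : 0 ≤ P) (x y : H) :
    ⟪P x, y⟫_ℂ = ⟪CFC.sqrt P x, CFC.sqrt P y⟫_ℂ := by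
  have hsa : ContinuousLinearMap.adjoint (CFC.sqrt P) = CFC.sqrt P :=
    (CFC.sqrt_nonneg P).isSelfAdjoint
  conv_lhs => rw [← CFC.sqrt_mul_sqrt_self P hP]
  rw [mul_apply_eq_comp, ← ContinuousLinearMap.adjoint_inner_right, hsa]

theorem traceIn_eq_hsSq {ι : Type*} (b : HilbertBasis ι ℂ H) {P : H →L[ℂ] H} (hP : 0 ≤ P) :
    traceIn b P = hsSq b (CFC.sqrt P) := by
  unfold traceIn hsSq
  refine tsum_congr fun i => ?_
  rw [sqrt_apply_inner hP, norm_sq_eq_re_inner (𝕜 := ℂ)]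

/-- The trace of a positive operator does not depend on the Hilbert basis. -/
theorem traceIn_eq_traceIn {ι κ : Type*} (b : HilbertBasis ι ℂ H) (c : HilbertBasis κ ℂ H)
    {P : H →L[ℂ] H} (hP : 0 ≤ P) : traceIn b P = traceIn c P := by
  have hsa : ContinuousLinearMap.adjoint (CFC.sqrt P) = CFC.sqrt P :=
    (CFC.sqrt_nonneg P).isSelfAdjoint
  rw [traceIn_eq_hsSq b hP, traceIn_eq_hsSq c hP, hsSq_adjoint b c, hsa]

theorem norm_abs_apply (A : H →L[ℂ] H) (x : H) : ‖CFC.abs A x‖ = ‖A x‖ := by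
  have hsa : ContinuousLinearMap.adjoint (CFC.abs A) = CFC.abs A :=
    (CFC.abs_nonneg A).isSelfAdjoint
  have h : ‖CFC.abs A x‖ ^ 2 = ‖A x‖ ^ 2 := by
    rw [norm_sq_eq_re_inner (𝕜 := ℂ), norm_sq_eq_re_inner (𝕜 := ℂ)]
    congr 1
    rw [← ContinuousLinearMap.adjoint_inner_right, hsa, ← mul_apply_eq_comp,
      CFC.abs_mul_abs, ContinuousLinearMap.star_eq_adjoint, mul_apply_eq_comp,
      ContinuousLinearMap.adjoint_inner_right]
  exact (pow_left_inj₀ (norm_nonneg _) (norm_nonneg _) two_ne_zero).1 h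

/-- Polar decomposition: `A = U |A|` and `|A| = U* A` with `U` a contraction. -/
theorem exists_polar (A : H →L[ℂ] H) : ∃ U : H →L[ℂ] H, ‖U‖ ≤ 1 ∧ U * CFC.abs A = A ∧
    ContinuousLinearMap.adjoint U * A = CFC.abs A := by
  set K : Submodule ℂ H := (LinearMap.range (CFC.abs A).toLinearMap).topologicalClosure with hK
  have hmem : ∀ x, CFC.abs A x ∈ K := fun x =>
    Submodule.le_topologicalClosure _ ⟨x, rfl⟩
  have : CompleteSpace K := (Submodule.isClosed_topologicalClosure _).completeSpace_coe
  let e : H →ₗ[ℂ] K := (CFC.abs A).toLinearMap.codRestrict K hmem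
  have hd : DenseRange e := by
    intro y
    have hy : (y : H) ∈ closure (Set.range (fun x : H => CFC.abs A x)) := y.2
    rw [Metric.mem_closure_iff] at hy ⊢
    intro ε hε
    obtain ⟨_, ⟨x, rfl⟩, hx⟩ := hy ε hε
    exact ⟨e x, ⟨x, rfl⟩, hx⟩
  have hn : ∀ x : H, ‖A.toLinearMap x‖ ≤ 1 * ‖e x‖ := fun x => by
    rw [one_mul]; exact (norm_abs_apply A x).ge
  let V : K →L[ℂ] H := A.toLinearMap.extendOfNorm e
  have hV : ‖V‖ ≤ 1 := LinearMap.opNorm_extendOfNorm_le hd zero_le_one hn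
  let U : H →L[ℂ] H := V.comp K.orthogonalProjectionOnto
  have hU1 : ‖U‖ ≤ 1 := by
    refine (V.opNorm_comp_le _).trans ?_
    exact mul_le_one₀ hV (norm_nonneg _) K.orthogonalProjectionOnto_norm_le
  have hUA : ∀ x, U (CFC.abs A x) = A x := by
    intro x
    have h1 : K.orthogonalProjectionOnto (CFC.abs A x) = e x :=
      K.orthogonalProjectionOnto_mem_subspace_eq_self (e x)
    change V (K.orthogonalProjectionOnto (CFC.abs A x)) = A x
    rw [h1]
    exact LinearMap.extendOfNorm_eq hd ⟨1, hn⟩ x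
  refine ⟨U, hU1, ContinuousLinearMap.ext hUA, ContinuousLinearMap.ext fun x => ?_⟩
  rw [mul_apply_eq_comp, ← sub_eq_zero, ← norm_le_zero_iff]
  have h2 : ‖ContinuousLinearMap.adjoint U (A x)‖ ≤ ‖A x‖ := by
    simpa using (ContinuousLinearMap.adjoint U).le_of_opNorm_le
      ((ContinuousLinearMap.adjoint.norm_map U).le.trans hU1) (A x)
  have h3 : RCLike.re ⟪ContinuousLinearMap.adjoint U (A x), CFC.abs A x⟫_ℂ = ‖A x‖ ^ 2 := by
    rw [ContinuousLinearMap.adjoint_inner_left, hUA, norm_sq_eq_re_inner (𝕜 := ℂ)]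
  have h4 := norm_sub_sq (𝕜 := ℂ) (ContinuousLinearMap.adjoint U (A x)) (CFC.abs A x)
  rw [h3, norm_abs_apply] at h4
  have h5 := norm_nonneg (ContinuousLinearMap.adjoint U (A x))
  nlinarith [norm_nonneg (ContinuousLinearMap.adjoint U (A x) - CFC.abs A x)]

theorem tsum_norm_inner_le {ι : Type*} (b : HilbertBasis ι ℂ H) (A W : H →L[ℂ] H)
    (hW : ‖W‖ ≤ 1) :
    ∑' i, ENNReal.ofReal ‖⟪A (b i), W (b i)⟫_ℂ‖ ≤ traceIn b (CFC.abs A) := by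
  obtain ⟨U, hU, hUA, -⟩ := exists_polar A
  set R := CFC.sqrt (CFC.abs A) with hR
  have hsa : ContinuousLinearMap.adjoint R = R := (CFC.sqrt_nonneg (CFC.abs A)).isSelfAdjoint
  have hX : hsSq b (R * (ContinuousLinearMap.adjoint U * W)) ≤ hsSq b R := by
    rw [hsSq_adjoint b b]
    have : ContinuousLinearMap.adjoint (R * (ContinuousLinearMap.adjoint U * W))
        = (ContinuousLinearMap.adjoint W * U) * R := by
      simp only [← ContinuousLinearMap.star_eq_adjoint, star_mul, star_star]
      rw [ContinuousLinearMap.star_eq_adjoint R, hsa]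
    rw [this]
    refine hsSq_comp_le b _ _ ((norm_mul_le _ _).trans ?_)
    exact mul_le_one₀ ((ContinuousLinearMap.adjoint.norm_map W).le.trans hW) (norm_nonneg _) hU
  have hpt : ∀ i, 2 * ENNReal.ofReal ‖⟪A (b i), W (b i)⟫_ℂ‖ ≤
      ENNReal.ofReal (‖R (b i)‖ ^ 2) +
        ENNReal.ofReal (‖(R * (ContinuousLinearMap.adjoint U * W)) (b i)‖ ^ 2) := by
    intro i
    have h1 : ⟪A (b i), W (b i)⟫_ℂ
        = ⟪R (b i), (R * (ContinuousLinearMap.adjoint U * W)) (b i)⟫_ℂ := by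
      conv_lhs => rw [← hUA]
      simp only [mul_apply_eq_comp]
      rw [← ContinuousLinearMap.adjoint_inner_right, sqrt_apply_inner (CFC.abs_nonneg A)]
    have h2 := norm_inner_le_norm (𝕜 := ℂ) (R (b i))
      ((R * (ContinuousLinearMap.adjoint U * W)) (b i))
    rw [← h1] at h2
    rw [← ENNReal.ofReal_add (by positivity) (by positivity),
      show (2 : ℝ≥0∞) = ENNReal.ofReal 2 by simp, ← ENNReal.ofReal_mul (by norm_num)]
    refine ENNReal.ofReal_le_ofReal ?_
    nlinarith [sq_nonneg (‖R (b i)‖ - ‖(R * (ContinuousLinearMap.adjoint U * W)) (b i)‖)]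
  have h : 2 * ∑' i, ENNReal.ofReal ‖⟪A (b i), W (b i)⟫_ℂ‖ ≤ 2 * traceIn b (CFC.abs A) := by
    rw [← ENNReal.tsum_mul_left, two_mul, traceIn_eq_hsSq b (CFC.abs_nonneg A)]
    refine (ENNReal.tsum_le_tsum hpt).trans ?_
    rw [ENNReal.tsum_add]
    exact add_le_add le_rfl hX
  exact (ENNReal.mul_le_mul_iff_right (by simp) (by simp)).1 h

theorem traceIn_abs_add_le {ι : Type*} (b : HilbertBasis ι ℂ H) (A B : H →L[ℂ] H) :
    traceIn b (CFC.abs (A + B)) ≤ traceIn b (CFC.abs A) + traceIn b (CFC.abs B) := by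
  obtain ⟨U, hU, -, hUA⟩ := exists_polar (A + B)
  refine le_trans ?_ (add_le_add (tsum_norm_inner_le b A U hU) (tsum_norm_inner_le b B U hU))
  rw [← ENNReal.tsum_add]
  refine ENNReal.tsum_le_tsum fun i => ?_
  rw [← hUA, ← ENNReal.ofReal_add (norm_nonneg _) (norm_nonneg _)]
  refine ENNReal.ofReal_le_ofReal ?_
  rw [mul_apply_eq_comp, ContinuousLinearMap.adjoint_inner_left,
    add_apply, inner_add_left, map_add]
  exact add_le_add (RCLike.re_le_norm _) (RCLike.re_le_norm _)

theorem traceIn_abs_smul {ι : Type*} (b : HilbertBasis ι ℂ H) (c : ℂ) (A : H →L[ℂ] H) :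
    traceIn b (CFC.abs (c • A)) = ENNReal.ofReal ‖c‖ * traceIn b (CFC.abs A) := by
  unfold traceIn
  rw [← ENNReal.tsum_mul_left, CFC.abs_smul]
  refine tsum_congr fun i => ?_
  rw [← ENNReal.ofReal_mul (norm_nonneg c)]
  congr 1
  rw [smul_apply, RCLike.real_smul_eq_coe_smul (K := ℂ), inner_smul_left]
  simp

theorem eq_zero_of_traceIn_abs_eq_zero {ι : Type*} (b : HilbertBasis ι ℂ H) (A : H →L[ℂ] H)
    (h : traceIn b (CFC.abs A) = 0) : A = 0 := by
  have hsa : ContinuousLinearMap.adjoint (CFC.sqrt (CFC.abs A)) = CFC.sqrt (CFC.abs A) :=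
    (CFC.sqrt_nonneg (CFC.abs A)).isSelfAdjoint
  rw [traceIn_eq_hsSq b (CFC.abs_nonneg A), ← hsa, ← hsSq_adjoint b b] at h
  have h0 : ∀ i, CFC.sqrt (CFC.abs A) (b i) = 0 := by
    intro i
    have := ENNReal.tsum_eq_zero.1 h i
    rw [ENNReal.ofReal_eq_zero] at this
    have h2 : ‖CFC.sqrt (CFC.abs A) (b i)‖ ^ 2 = 0 := le_antisymm this (by positivity)
    simpa using h2
  have hR : CFC.sqrt (CFC.abs A) = 0 := by
    refine ContinuousLinearMap.ext_on
      ((Submodule.dense_iff_topologicalClosure_eq_top).2 b.dense_span) ?_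
    rintro _ ⟨i, rfl⟩
    simpa using h0 i
  have hA : CFC.abs A = 0 := by
    rw [← CFC.sqrt_mul_sqrt_self (CFC.abs A) (CFC.abs_nonneg A), hR, mul_zero]
  ext x
  have := norm_abs_apply A x
  rw [hA] at this
  simpa using this.symm

/-- A choice of a Hilbert basis of `H`. -/
def basis (H : Type*) [NormedAddCommGroup H] [InnerProductSpace ℂ H] [CompleteSpace H] :
    HilbertBasis ↥(Classical.choose (exists_hilbertBasis ℂ H) : Set H) ℂ H :=
  Classical.choose (Classical.choose_spec (exists_hilbertBasis ℂ H))

/-- The trace norm `Tr |A| ∈ [0, ∞]` of a bounded operator `A`, where `|A| = (A* A)^{1/2}`. -/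
def eTraceNorm (A : H →L[ℂ] H) : ℝ≥0∞ := traceIn (basis H) (CFC.abs A)

theorem eTraceNorm_eq {ι : Type*} (b : HilbertBasis ι ℂ H) (A : H →L[ℂ] H) :
    eTraceNorm A = traceIn b (CFC.abs A) :=
  traceIn_eq_traceIn _ b (CFC.abs_nonneg A)

/-- The trace class operators, `{A : Tr |A| < ∞}`, as a linear subspace of `B(H)`. -/
def traceClass (H : Type*) [NormedAddCommGroup H] [InnerProductSpace ℂ H] [CompleteSpace H] :
    Submodule ℂ (H →L[ℂ] H) where
  carrier := {A | eTraceNorm A < ∞}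
  zero_mem' := by simp [eTraceNorm, traceIn]
  add_mem' := fun {A B} hA hB =>
    (traceIn_abs_add_le (basis H) A B).trans_lt (ENNReal.add_lt_top.2 ⟨hA, hB⟩)
  smul_mem' := fun c A hA => by
    change traceIn (basis H) (CFC.abs (c • A)) < ∞
    rw [traceIn_abs_smul]
    exact ENNReal.mul_lt_top ENNReal.ofReal_lt_top hA

end SchattenOne

/-- The Schatten space `S₁(H)`: the operators `A` on `H` with `Tr |A| < ∞`, normed by
`‖A‖ = Tr |A|`. It is a type of its own, so that the operator norm is not inherited. -/
def SchattenOne (H : Type*) [NormedAddCommGroup H] [InnerProductSpace ℂ H] [CompleteSpace H] :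
    Type _ := SchattenOne.traceClass H

namespace SchattenOne

variable {H : Type*} [NormedAddCommGroup H] [InnerProductSpace ℂ H] [CompleteSpace H]

instance : AddCommGroup (SchattenOne H) := inferInstanceAs (AddCommGroup (traceClass H))

instance : Module ℂ (SchattenOne H) := inferInstanceAs (Module ℂ (traceClass H))

/-- The underlying bounded operator of an element of `S₁(H)`. -/
def toOperator : SchattenOne H →ₗ[ℂ] (H →L[ℂ] H) := (traceClass H).subtype

instance : Norm (SchattenOne H) := ⟨fun A => (eTraceNorm (toOperator A)).toReal⟩

theorem norm_def (A : SchattenOne H) : ‖A‖ = (eTraceNorm (toOperator A)).toReal := rfl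

theorem eTraceNorm_lt_top (A : SchattenOne H) : eTraceNorm (toOperator A) < ∞ := A.2

theorem toOperator_injective : Function.Injective (toOperator (H := H)) := Subtype.val_injective

theorem normedSpaceCore : NormedSpace.Core ℂ (SchattenOne H) where
  norm_nonneg _ := ENNReal.toReal_nonneg
  norm_smul c A := by
    rw [norm_def, norm_def, map_smul, eTraceNorm, traceIn_abs_smul, ENNReal.toReal_mul,
      ENNReal.toReal_ofReal (norm_nonneg c), eTraceNorm]
  norm_triangle A B := by
    rw [norm_def, norm_def, norm_def, map_add, ← ENNReal.toReal_add
      (eTraceNorm_lt_top A).ne (eTraceNorm_lt_top B).ne]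
    exact ENNReal.toReal_mono (ENNReal.add_lt_top.2 ⟨eTraceNorm_lt_top A, eTraceNorm_lt_top B⟩).ne
      (traceIn_abs_add_le (basis H) _ _)
  norm_eq_zero_iff A := by
    rw [norm_def, ENNReal.toReal_eq_zero_iff, or_iff_left (eTraceNorm_lt_top A).ne]
    constructor
    · intro h
      apply toOperator_injective
      rw [map_zero]
      exact eq_zero_of_traceIn_abs_eq_zero _ _ h
    · rintro rfl
      simp [eTraceNorm, traceIn]

instance : NormedAddCommGroup (SchattenOne H) := NormedAddCommGroup.ofCore normedSpaceCore

instance : NormedSpace ℂ (SchattenOne H) := NormedSpace.ofCore normedSpaceCore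

end SchattenOne

section Operators

variable {X Y : Type*} [NormedAddCommGroup X] [NormedSpace ℂ X]
  [NormedAddCommGroup Y] [NormedSpace ℂ Y]

/-- `T` is Dunford-Pettis: it takes weakly compact sets to relatively (norm) compact sets. -/
def IsDunfordPettis (T : X →L[ℂ] Y) : Prop :=
  ∀ K : Set X, IsCompact (toWeakSpace ℂ X '' K) → IsCompact (closure (T '' K))

/-- `T` is `W`-compact: its restriction to every subspace of `X` isomorphic (as a topological vector
space) to `W` is compact. When `W` is complete such a subspace is complete, hence closed in `X`. -/
def IsCompactOnCopiesOf (W : Type*) [NormedAddCommGroup W] [NormedSpace ℂ W]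
    (T : X →L[ℂ] Y) : Prop :=
  ∀ E : Submodule ℂ X, Nonempty (E ≃L[ℂ] W) → IsCompactOperator (T.comp E.subtypeL)

end Operators

end

noncomputable section

set_option linter.unusedSectionVars false

open scoped InnerProductSpace ENNReal
open Filter Topology

/-! ### Trace norm estimates through Hilbert–Schmidt factorizations; rows and columns. -/

namespace SchattenOne

variable {H : Type*} [NormedAddCommGroup H] [InnerProductSpace ℂ H] [CompleteSpace H]

/-! The closed unit ball of a Hilbert space is weakly compact, and so is its image under a bounded
operator; hence a Dunford–Pettis operator is compact on every copy of `ℓ₂`.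

Conversely, fix a Hilbert basis, let `P` be the projection onto finitely many basis vectors and `Q =
1 - P`. Then `A - Q A Q = P A + Q A P` is a finite sum of rows and columns, each lying in an
isometric copy of a separable Hilbert space. So `A ↦ T (A - Q A Q)` is compact as soon as `T` is
compact on the copies of `ℓ₂` (`isCompactOperator_comp_sub_sandwich`).

It remains to make the corner `Q A Q` uniformly small in trace norm over a weakly compact set `K`
(`exists_norm_sandwich_one_sub_coordProj_le`). If this fails, a gliding hump gives points of `K`
with large diagonal blocks over pairwise disjoint sets of coordinates. Norming functionals of these
blocks define a bounded operator into `ℓ₁`, since passing to the block diagonal does not increase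
the trace norm. A subsequence of the points converges weakly, and the Schur property of `ℓ₁` gives a
contradiction. -/

theorem two_mul_ofReal_norm_inner_le (x y : H) {c : ℝ} (hc : 0 < c) :
    2 * ENNReal.ofReal ‖⟪x, y⟫_ℂ‖ ≤
      ENNReal.ofReal c * ENNReal.ofReal (‖x‖ ^ 2) +
        ENNReal.ofReal c⁻¹ * ENNReal.ofReal (‖y‖ ^ 2) := by
  have h := norm_inner_le_norm (𝕜 := ℂ) x y
  rw [← ENNReal.ofReal_mul hc.le, ← ENNReal.ofReal_mul (inv_pos.2 hc).le,
    ← ENNReal.ofReal_add (by positivity) (by positivity),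
    show (2 : ℝ≥0∞) = ENNReal.ofReal 2 by simp, ← ENNReal.ofReal_mul (by norm_num)]
  refine ENNReal.ofReal_le_ofReal ?_
  have e : c * ‖x‖ ^ 2 + c⁻¹ * ‖y‖ ^ 2 - 2 * (‖x‖ * ‖y‖) = c⁻¹ * (c * ‖x‖ - ‖y‖) ^ 2 := by
    field_simp
    ring
  have : 0 ≤ c⁻¹ * (c * ‖x‖ - ‖y‖) ^ 2 := by positivity
  linarith

theorem hsSq_mul_le {ι : Type*} (b : HilbertBasis ι ℂ H) (W S : H →L[ℂ] H) :
    hsSq b (W * S) ≤ ENNReal.ofReal (‖W‖ ^ 2) * hsSq b S := by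
  unfold hsSq
  rw [← ENNReal.tsum_mul_left]
  refine ENNReal.tsum_le_tsum fun i => ?_
  rw [← ENNReal.ofReal_mul (by positivity), ← mul_pow]
  exact ENNReal.ofReal_le_ofReal (pow_le_pow_left₀ (norm_nonneg _) (W.le_opNorm _) 2)

theorem hsSq_mul_right_le {ι : Type*} (b : HilbertBasis ι ℂ H) (S W : H →L[ℂ] H) :
    hsSq b (S * W) ≤ ENNReal.ofReal (‖W‖ ^ 2) * hsSq b S := by
  rw [hsSq_adjoint b b, hsSq_adjoint b b S, ← ContinuousLinearMap.star_eq_adjoint, star_mul,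
    ContinuousLinearMap.star_eq_adjoint, ContinuousLinearMap.star_eq_adjoint,
    ← ContinuousLinearMap.adjoint.norm_map W]
  exact hsSq_mul_le b _ _

/-- Writing `|S* T| = U* S* T` turns the trace into a sum of inner products of `T bᵢ` with `S U bᵢ`,
and `U` is a contraction. This is `‖S* T‖₁ ≤ ‖S‖₂ ‖T‖₂` with the product replaced by weighted means;
the free weight `c` lets a small factor compensate for a merely bounded one. -/
theorem two_mul_eTraceNorm_adjoint_mul_le {ι : Type*} (b : HilbertBasis ι ℂ H)
    (S T : H →L[ℂ] H) {c : ℝ} (hc : 0 < c) :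
    2 * eTraceNorm (ContinuousLinearMap.adjoint S * T) ≤
      ENNReal.ofReal c * hsSq b S + ENNReal.ofReal c⁻¹ * hsSq b T := by
  obtain ⟨U, hU, -, hUA⟩ := exists_polar (ContinuousLinearMap.adjoint S * T)
  have hSU : hsSq b (S * U) ≤ hsSq b S := by
    refine (hsSq_mul_right_le b S U).trans (mul_le_of_le_one_left' ?_)
    rw [ENNReal.ofReal_le_one]
    exact pow_le_one₀ (norm_nonneg _) hU
  calc 2 * eTraceNorm (ContinuousLinearMap.adjoint S * T)
      ≤ ENNReal.ofReal c * hsSq b (S * U) + ENNReal.ofReal c⁻¹ * hsSq b T := by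
        rw [eTraceNorm_eq b]
        unfold traceIn hsSq
        rw [← ENNReal.tsum_mul_left, ← ENNReal.tsum_mul_left, ← ENNReal.tsum_mul_left,
          ← ENNReal.tsum_add]
        refine ENNReal.tsum_le_tsum fun i => ?_
        refine le_trans ?_ (two_mul_ofReal_norm_inner_le ((S * U) (b i)) (T (b i)) hc)
        gcongr
        rw [← hUA, norm_inner_symm, mul_apply_eq_comp, ContinuousLinearMap.adjoint_inner_left,
          mul_apply_eq_comp, ContinuousLinearMap.adjoint_inner_left]
        exact RCLike.re_le_norm _
    _ ≤ _ := by gcongr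

/-- From the polar decomposition, `A = (U |A|^{1/2}) |A|^{1/2}`. With
`two_mul_eTraceNorm_adjoint_mul_le` it reduces trace norm estimates to Hilbert–Schmidt ones. -/
theorem exists_eq_adjoint_mul {ι : Type*} (b : HilbertBasis ι ℂ H) (A : H →L[ℂ] H) :
    ∃ S T : H →L[ℂ] H, ContinuousLinearMap.adjoint S * T = A ∧
      hsSq b S ≤ eTraceNorm A ∧ hsSq b T ≤ eTraceNorm A := by
  obtain ⟨U, hU, hUA, -⟩ := exists_polar A
  set R := CFC.sqrt (CFC.abs A) with hR
  have hsa : ContinuousLinearMap.adjoint R = R := (CFC.sqrt_nonneg (CFC.abs A)).isSelfAdjoint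
  refine ⟨ContinuousLinearMap.adjoint (U * R), R, ?_, ?_, ?_⟩
  · rw [ContinuousLinearMap.adjoint_adjoint, mul_assoc,
      CFC.sqrt_mul_sqrt_self _ (CFC.abs_nonneg A), hUA]
  · rw [← hsSq_adjoint b b, eTraceNorm_eq b, traceIn_eq_hsSq b (CFC.abs_nonneg A)]
    exact hsSq_comp_le b _ _ hU
  · rw [eTraceNorm_eq b, traceIn_eq_hsSq b (CFC.abs_nonneg A)]

/-- The outer factors are absorbed into the two Hilbert–Schmidt factors of `A`. The bound is not
sharp, but only continuity of `sandwich` is needed. -/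
theorem eTraceNorm_mul_mul_le (W A V : H →L[ℂ] H) :
    2 * eTraceNorm (W * A * V) ≤ ENNReal.ofReal (‖W‖ ^ 2 + ‖V‖ ^ 2) * eTraceNorm A := by
  obtain ⟨S, T, rfl, hS, hT⟩ := exists_eq_adjoint_mul (basis H) A
  have e : W * (ContinuousLinearMap.adjoint S * T) * V =
      ContinuousLinearMap.adjoint (S * ContinuousLinearMap.adjoint W) * (T * V) := by
    simp only [← ContinuousLinearMap.star_eq_adjoint, star_mul, star_star, mul_assoc]
  rw [e, ENNReal.ofReal_add (by positivity) (by positivity), add_mul]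
  refine (two_mul_eTraceNorm_adjoint_mul_le (basis H) _ _ one_pos).trans ?_
  simp only [ENNReal.ofReal_one, inv_one, one_mul]
  refine add_le_add ((hsSq_mul_right_le _ _ _).trans ?_) ((hsSq_mul_right_le _ _ _).trans ?_)
  · rw [ContinuousLinearMap.adjoint.norm_map]
    gcongr
  · gcongr

theorem eTraceNorm_mul_mul_lt_top (W V : H →L[ℂ] H) {A : H →L[ℂ] H} (hA : eTraceNorm A < ∞) :
    eTraceNorm (W * A * V) < ∞ := by
  have h := (eTraceNorm_mul_mul_le W A V).trans_lt (ENNReal.mul_lt_top ENNReal.ofReal_lt_top hA)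
  rw [two_mul] at h
  exact (ENNReal.add_lt_top.1 h).1

/-- The two-sided multiplication `A ↦ W A V` on `S₁(H)`. -/
def sandwich (W V : H →L[ℂ] H) : SchattenOne H →L[ℂ] SchattenOne H :=
  LinearMap.mkContinuous
    { toFun := fun A => (⟨W * toOperator A * V,
        eTraceNorm_mul_mul_lt_top W V (eTraceNorm_lt_top A)⟩ : traceClass H)
      map_add' := fun A B => Subtype.ext (by simp [mul_add, add_mul]; rfl)
      map_smul' := fun c A => Subtype.ext (by simp; rfl) }
    ((‖W‖ ^ 2 + ‖V‖ ^ 2) / 2) fun A => by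
      have h := ENNReal.toReal_mono
        (ENNReal.mul_lt_top ENNReal.ofReal_lt_top (eTraceNorm_lt_top A)).ne
        (eTraceNorm_mul_mul_le W (toOperator A) V)
      rw [ENNReal.toReal_mul, ENNReal.toReal_mul, ENNReal.toReal_ofReal (by positivity)] at h
      change (eTraceNorm (W * toOperator A * V)).toReal ≤ _
      rw [norm_def]
      simp only [ENNReal.toReal_ofNat] at h
      linarith

theorem toOperator_sandwich (W V : H →L[ℂ] H) (A : SchattenOne H) :
    toOperator (sandwich W V A) = W * toOperator A * V := rfl

theorem ofReal_norm (A : SchattenOne H) : ENNReal.ofReal ‖A‖ = eTraceNorm (toOperator A) :=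
  ENNReal.ofReal_toReal (eTraceNorm_lt_top A).ne

theorem norm_sq_le_of_hsSq_le {ι : Type*} (b : HilbertBasis ι ℂ H) {S : H →L[ℂ] H} {r : ℝ}
    (hr : 0 ≤ r) (h : hsSq b S ≤ ENNReal.ofReal r) : ‖S‖ ^ 2 ≤ r := by
  have hSx : ∀ x, ‖S x‖ ^ 2 ≤ r * ‖x‖ ^ 2 := by
    intro x
    rw [← ENNReal.ofReal_le_ofReal_iff (by positivity), ← tsum_ofReal_norm_inner_sq b,
      ENNReal.ofReal_mul hr]
    rw [hsSq_adjoint b b] at h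
    refine le_trans ?_ (mul_le_mul_left h _)
    rw [hsSq, ← ENNReal.tsum_mul_right]
    refine ENNReal.tsum_le_tsum fun i => ?_
    rw [← ENNReal.ofReal_mul (by positivity)]
    refine ENNReal.ofReal_le_ofReal ?_
    rw [← ContinuousLinearMap.adjoint_inner_left, ← mul_pow]
    exact pow_le_pow_left₀ (norm_nonneg _) (norm_inner_le_norm _ _) 2
  have : ‖S‖ ≤ Real.sqrt r := by
    refine S.opNorm_le_bound (Real.sqrt_nonneg _) fun x => ?_
    refine (pow_le_pow_iff_left₀ (norm_nonneg _) (by positivity) two_ne_zero).1 ?_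
    rw [mul_pow, Real.sq_sqrt hr]
    exact hSx x
  calc ‖S‖ ^ 2 ≤ Real.sqrt r ^ 2 := by gcongr
    _ = r := Real.sq_sqrt hr

theorem norm_toOperator_le (A : SchattenOne H) : ‖toOperator A‖ ≤ ‖A‖ := by
  obtain ⟨S, T, hA, hS, hT⟩ := exists_eq_adjoint_mul (basis H) (toOperator A)
  rw [← ofReal_norm] at hS hT
  have hS' := norm_sq_le_of_hsSq_le _ (norm_nonneg A) hS
  have hT' := norm_sq_le_of_hsSq_le _ (norm_nonneg A) hT
  have h : ‖toOperator A‖ ≤ ‖S‖ * ‖T‖ := by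
    rw [← hA]
    exact (norm_mul_le _ _).trans (by rw [ContinuousLinearMap.adjoint.norm_map])
  nlinarith [sq_nonneg (‖S‖ - ‖T‖)]

/-- The inclusion `S₁(H) → B(H)` as a continuous linear map. -/
def toOperatorL : SchattenOne H →L[ℂ] (H →L[ℂ] H) :=
  toOperator.mkContinuous 1 fun A => by simpa using norm_toOperator_le A

@[simp] theorem toOperatorL_apply (A : SchattenOne H) : toOperatorL A = toOperator A := rfl

theorem hsSq_rankOne {ι : Type*} (b : HilbertBasis ι ℂ H) (u v : H) :
    hsSq b (InnerProductSpace.rankOne ℂ u v) = ENNReal.ofReal (‖u‖ ^ 2 * ‖v‖ ^ 2) := by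
  unfold hsSq
  rw [ENNReal.ofReal_mul (by positivity), ← tsum_ofReal_norm_inner_sq b v, ← ENNReal.tsum_mul_left]
  refine tsum_congr fun i => ?_
  rw [← ENNReal.ofReal_mul (by positivity), InnerProductSpace.rankOne_apply, norm_smul,
    norm_inner_symm]
  congr 1
  ring

theorem eTraceNorm_rankOne_le {u : H} (hu : ‖u‖ = 1) (v : H) :
    eTraceNorm (InnerProductSpace.rankOne ℂ u v) ≤ ENNReal.ofReal ‖v‖ := by
  rcases eq_or_ne v 0 with rfl | hv
  · simp [eTraceNorm, traceIn]
  have hv' := norm_pos_iff.2 hv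
  -- The factors have Hilbert–Schmidt norms `1` and `‖v‖`, so the weight `‖v‖` balances the two
  -- terms.
  have h := two_mul_eTraceNorm_adjoint_mul_le (basis H) (InnerProductSpace.rankOne ℂ u u)
    (InnerProductSpace.rankOne ℂ u v) hv'
  have e : ContinuousLinearMap.adjoint (InnerProductSpace.rankOne ℂ u u) *
      InnerProductSpace.rankOne ℂ u v = InnerProductSpace.rankOne ℂ u v := by
    rw [InnerProductSpace.adjoint_rankOne]
    ext x
    simp [hu, inner_self_eq_norm_sq_to_K]
  rw [e, hsSq_rankOne, hsSq_rankOne, hu, ← ENNReal.ofReal_mul hv'.le,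
    ← ENNReal.ofReal_mul (by positivity), ← ENNReal.ofReal_add (by positivity) (by positivity),
    show ‖v‖ * (1 ^ 2 * 1 ^ 2) + ‖v‖⁻¹ * (1 ^ 2 * ‖v‖ ^ 2) = 2 * ‖v‖ by field_simp; norm_num,
    ENNReal.ofReal_mul (by norm_num), ENNReal.ofReal_ofNat] at h
  exact (ENNReal.mul_le_mul_iff_right (by simp) (by simp)).1 h

theorem eTraceNorm_adjoint_le (A : H →L[ℂ] H) :
    eTraceNorm (ContinuousLinearMap.adjoint A) ≤ eTraceNorm A := by
  obtain ⟨S, T, rfl, hS, hT⟩ := exists_eq_adjoint_mul (basis H) A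
  set a := eTraceNorm (ContinuousLinearMap.adjoint S * T)
  have h := two_mul_eTraceNorm_adjoint_mul_le (basis H) T S one_pos
  simp only [ENNReal.ofReal_one, inv_one, one_mul] at h
  rw [← ContinuousLinearMap.star_eq_adjoint, ← ContinuousLinearMap.star_eq_adjoint, star_mul,
    star_star, ContinuousLinearMap.star_eq_adjoint]
  refine (ENNReal.mul_le_mul_iff_right (a := 2) (by simp) (by simp)).1 (h.trans ?_)
  rw [two_mul]
  exact add_le_add hT hS

/-- The column `w ↦ w ⊗ v*` in `S₁(H)`, for a unit vector `v`. -/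
def column {v : H} (hv : ‖v‖ = 1) : H →ₗᵢ[ℂ] SchattenOne H where
  toFun w := (⟨InnerProductSpace.rankOne ℂ w v, by
    rw [← InnerProductSpace.adjoint_rankOne]
    exact (eTraceNorm_adjoint_le _).trans_lt
      ((eTraceNorm_rankOne_le hv w).trans_lt ENNReal.ofReal_lt_top)⟩ : traceClass H)
  map_add' x y := Subtype.ext (by simp; rfl)
  map_smul' c x := Subtype.ext (by simp; rfl)
  norm_map' w := by
    apply le_antisymm
    · refine ENNReal.toReal_le_of_le_ofReal (norm_nonneg w) ?_
      change eTraceNorm (InnerProductSpace.rankOne ℂ w v) ≤ _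
      rw [← InnerProductSpace.adjoint_rankOne]
      exact (eTraceNorm_adjoint_le _).trans (eTraceNorm_rankOne_le hv w)
    · refine le_trans ?_ (norm_toOperator_le _)
      change ‖w‖ ≤ ‖InnerProductSpace.rankOne ℂ w v‖
      simp [hv]

theorem toOperator_column {v : H} (hv : ‖v‖ = 1) (w : H) :
    toOperator (column hv w) = InnerProductSpace.rankOne ℂ w v := rfl

/-- The row `φ ↦ v ⊗ φ` in `S₁(H)`, for a unit vector `v`. -/
def row {v : H} (hv : ‖v‖ = 1) : StrongDual ℂ H →ₗᵢ[ℂ] SchattenOne H where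
  -- A row depends conjugate-linearly on its vector; taking the functional as variable makes the map
  -- linear.
  toFun φ := (⟨φ.smulRight v, by
    obtain ⟨w, rfl⟩ := (InnerProductSpace.toDual ℂ H).surjective φ
    exact (eTraceNorm_rankOne_le hv w).trans_lt ENNReal.ofReal_lt_top⟩ : traceClass H)
  map_add' x y := Subtype.ext (by ext; simp [add_smul]; rfl)
  map_smul' c x := Subtype.ext (by ext; simp [mul_smul]; rfl)
  norm_map' φ := by
    apply le_antisymm
    · obtain ⟨w, rfl⟩ := (InnerProductSpace.toDual ℂ H).surjective φ
      refine ENNReal.toReal_le_of_le_ofReal (norm_nonneg _) ?_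
      rw [LinearIsometryEquiv.norm_map]
      exact eTraceNorm_rankOne_le hv w
    · refine le_trans ?_ (norm_toOperator_le _)
      change ‖φ‖ ≤ ‖φ.smulRight v‖
      simp [hv]

theorem toOperator_row {v : H} (hv : ‖v‖ = 1) (φ : StrongDual ℂ H) :
    toOperator (row hv φ) = φ.smulRight v := rfl

end SchattenOne

/-! ### Weak compactness, the Schur property, and operators on copies of Hilbert space. -/

section WeakTopology

variable {X : Type*} [NormedAddCommGroup X] [NormedSpace ℂ X]

/-- The Schur property of `ℓ₁`, for a weakly convergent sequence and a sequence of functionals that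
defines an operator into `ℓ₁`. -/
theorem exists_forall_notMem_norm_le_of_weakly_tendsto {Φ : ℕ → StrongDual ℂ X} {C : ℝ}
    (hΦ : ∀ x, ∀ s : Finset ℕ, ∑ k ∈ s, ‖Φ k x‖ ≤ C * ‖x‖) {y : ℕ → X}
    (hy : ∀ f : StrongDual ℂ X, Tendsto (fun j => f (y j)) atTop (𝓝 0)) {ε : ℝ} (hε : 0 < ε) :
    ∃ N, ∃ I : Finset ℕ, ∀ j ≥ N, ∀ k ∉ I, ‖Φ k (y j)‖ ≤ ε := by
  have hsum : ∀ x, Summable fun k => ‖Φ k x‖ := fun x =>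
    summable_of_sum_le (fun _ => norm_nonneg _) (hΦ x)
  let g (a : ℕ → Bool) (x : X) (k : ℕ) : ℂ := if a k then Φ k x else 0
  have hg : ∀ a x k, ‖g a x k‖ ≤ ‖Φ k x‖ := by
    intro a x k
    simp only [g]
    split_ifs <;> simp
  have hgs : ∀ a x, Summable (g a x) := fun a x => (hsum x).of_norm_bounded (hg a x)
  -- For each set `a` of indices, `F a` is the sum of the `Φ k` over `a`; these functionals are
  -- parametrized by the Cantor space.
  let F (a : ℕ → Bool) : StrongDual ℂ X := LinearMap.mkContinuous
    { toFun := fun x => ∑' k, g a x k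
      map_add' := fun x z => by
        rw [← (hgs a x).tsum_add (hgs a z)]
        refine tsum_congr fun k => ?_
        simp only [g]
        split_ifs <;> simp
      map_smul' := fun c x => by
        rw [RingHom.id_apply, smul_eq_mul, ← tsum_mul_left]
        refine tsum_congr fun k => ?_
        simp only [g]
        split_ifs <;> simp } C fun x => by
      refine (norm_tsum_le_tsum_norm ((hsum x).of_nonneg_of_le (fun _ => norm_nonneg _)
        (hg a x))).trans ?_
      refine (Summable.tsum_le_tsum (hg a x) ((hsum x).of_nonneg_of_le (fun _ => norm_nonneg _)
        (hg a x)) (hsum x)).trans ?_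
      exact (hsum x).tsum_le_of_sum_le (hΦ x)
  have hF : ∀ a x, F a x = ∑' k, g a x k := fun _ _ => rfl
  have hcont : ∀ x, Continuous fun a => F a x := by
    intro x
    simp only [hF]
    refine continuous_tsum (fun k => ?_) (hsum x) fun k a => hg a x k
    exact (continuous_of_discreteTopology (f := fun b : Bool => if b then Φ k x else 0)).comp
      (continuous_apply k)
  -- Baire category on the Cantor space: weak convergence becomes uniform in `a` on a nonempty open
  -- set, which restricts only the finitely many coordinates in `I`.
  obtain ⟨N, hN⟩ := nonempty_interior_of_iUnion_of_closed
    (f := fun N : ℕ => {a : ℕ → Bool | ∀ j ≥ N, ‖F a (y j)‖ ≤ ε / 2})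
    (fun N => by
      simp only [Set.ofPred_forall]
      exact isClosed_iInter fun j => isClosed_iInter fun _ =>
        isClosed_le (hcont (y j)).norm continuous_const)
    (by
      refine Set.eq_univ_of_forall fun a => Set.mem_iUnion.2 ?_
      have h := (hy (F a)).norm
      rw [norm_zero] at h
      obtain ⟨N, hN⟩ := eventually_atTop.1 (h.eventually_le_const (half_pos hε))
      exact ⟨N, hN⟩)
  obtain ⟨a, ha⟩ := hN
  obtain ⟨I, u, hu, hI⟩ := isOpen_pi_iff.1 isOpen_interior a ha
  refine ⟨N, I, fun j hj k hk => ?_⟩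
  -- A coordinate `k ∉ I` can be switched on or off without leaving the open set; the difference of
  -- the two functionals is `Φ k`.
  have hmem : ∀ b, Function.update a k b ∈
      {a : ℕ → Bool | ∀ j ≥ N, ‖F a (y j)‖ ≤ ε / 2} := by
    intro b
    refine interior_subset (hI fun i hi => ?_)
    rw [Function.update_of_ne (by rintro rfl; exact hk hi)]
    exact (hu i hi).2
  have hdiff : F (Function.update a k true) (y j) - F (Function.update a k false) (y j)
      = Φ k (y j) := by
    rw [hF, hF, ← (hgs _ _).tsum_sub (hgs _ _), tsum_eq_single k]
    · simp [g]
    · intro i hi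
      simp [g, Function.update_of_ne hi]
  rw [← hdiff]
  refine (norm_sub_le _ _).trans ?_
  linarith [hmem true j hj, hmem false j hj]

theorem continuous_apply_toWeakSpace_symm (f : StrongDual ℂ X) :
    Continuous fun x : WeakSpace ℂ X => f ((toWeakSpace ℂ X).symm x) :=
  WeakBilin.eval_continuous _ f

/-- Weakly compact sets are bounded. -/
theorem exists_norm_le_of_isCompact_toWeakSpace {K : Set X}
    (hK : IsCompact (toWeakSpace ℂ X '' K)) : ∃ M, 0 ≤ M ∧ ∀ x ∈ K, ‖x‖ ≤ M := by
  -- Uniform boundedness is applied to the points of `K` as functionals on the dual, which is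
  -- complete even if `X` is not.
  obtain ⟨M, hM⟩ := banach_steinhaus
    (g := fun x : K => NormedSpace.inclusionInDoubleDual ℂ X (x : X)) (fun f => by
      obtain ⟨C, hC⟩ := (hK.image (continuous_apply_toWeakSpace_symm f)).isBounded.exists_norm_le
      refine ⟨C, fun x => hC _ ⟨_, ⟨x, x.2, rfl⟩, ?_⟩⟩
      simp)
  refine ⟨max M 0, le_max_right _ _, fun x hx => ?_⟩
  refine le_trans ?_ ((hM ⟨x, hx⟩).trans (le_max_left _ _))
  exact ((NormedSpace.inclusionInDoubleDualLi ℂ (E := X)).norm_map x).ge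

/-- A weakly compact set on which countably many functionals separate points is weakly sequentially
compact. -/
theorem exists_subseq_weakly_tendsto {K : Set X} (hK : IsCompact (toWeakSpace ℂ X '' K))
    {κ : Type*} [Countable κ] (f : κ → StrongDual ℂ X)
    (hf : ∀ x z, (∀ k, f k x = f k z) → x = z) {x : ℕ → X} (hx : ∀ n, x n ∈ K) :
    ∃ z ∈ K, ∃ φ : ℕ → ℕ, StrictMono φ ∧
      ∀ g : StrongDual ℂ X, Tendsto (fun j => g (x (φ j))) atTop (𝓝 (g z)) := by
  let K' : Set (WeakSpace ℂ X) := toWeakSpace ℂ X '' K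
  have : CompactSpace K' := isCompact_iff_compactSpace.1 hK
  let e : K' → κ → ℂ := fun w k => f k ((toWeakSpace ℂ X).symm w)
  have he : Continuous e := continuous_pi fun k =>
    (continuous_apply_toWeakSpace_symm (f k)).comp continuous_subtype_val
  have hinj : Function.Injective e := fun u v h => Subtype.ext
    ((toWeakSpace ℂ X).symm.injective (hf _ _ fun k => congrFun h k))
  -- A continuous injection from a compact space into the metrizable product `κ → ℂ` is an
  -- embedding, so `K'` is metrizable and hence sequentially compact.
  have hemb : IsEmbedding e := (he.isClosedEmbedding hinj).isEmbedding
  have : TopologicalSpace.MetrizableSpace K' := hemb.metrizableSpace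
  obtain ⟨⟨_, z, hz, rfl⟩, φ, hφ, hlim⟩ := CompactSpace.tendsto_subseq
    (fun n => (⟨toWeakSpace ℂ X (x n), x n, hx n, rfl⟩ : K'))
  refine ⟨z, hz, φ, hφ, fun g => ?_⟩
  have hg : Continuous fun w : K' => g ((toWeakSpace ℂ X).symm w) :=
    (continuous_apply_toWeakSpace_symm g).comp continuous_subtype_val
  simpa [Function.comp_def] using (hg.tendsto _).comp hlim

variable {Y : Type*} [NormedAddCommGroup Y] [NormedSpace ℂ Y]

/-- Bounded operators on a Hilbert space map closed balls to weakly compact sets. -/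
theorem isCompact_toWeakSpace_image_closedBall {W : Type*} [NormedAddCommGroup W]
    [InnerProductSpace ℂ W] [CompleteSpace W] (S : W →L[ℂ] X) (r : ℝ) :
    IsCompact (toWeakSpace ℂ X '' (S '' Metric.closedBall 0 r)) := by
  -- Banach–Alaoglu is transported through the Riesz identification of `W` with its dual. That
  -- identification is conjugate-linear, whence the `star` in `h`.
  let e : WeakDual ℂ W → WeakSpace ℂ X := fun φ =>
    toWeakSpace ℂ X (S ((InnerProductSpace.toDual ℂ W).symm (WeakDual.toStrongDual φ)))
  have he : Continuous e := by
    refine WeakBilin.continuous_of_continuous_eval _ fun f => ?_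
    have h : ∀ φ : WeakDual ℂ W, f (S ((InnerProductSpace.toDual ℂ W).symm
        (WeakDual.toStrongDual φ))) =
        star (φ ((InnerProductSpace.toDual ℂ W).symm (f.comp S))) := by
      intro φ
      obtain ⟨w, hw⟩ := (InnerProductSpace.toDual ℂ W).surjective (WeakDual.toStrongDual φ)
      obtain ⟨v, hv⟩ := (InnerProductSpace.toDual ℂ W).surjective (f.comp S)
      have h1 : φ v = ⟪w, v⟫_ℂ := by
        rw [← InnerProductSpace.toDual_apply_apply, hw]
        rfl
      have h2 : f (S w) = ⟪v, w⟫_ℂ := by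
        rw [← InnerProductSpace.toDual_apply_apply, hv]
        rfl
      rw [← hw, ← hv, LinearIsometryEquiv.symm_apply_apply, LinearIsometryEquiv.symm_apply_apply,
        h1, h2, ← inner_conj_symm]
      rfl
    change Continuous fun φ : WeakDual ℂ W => f (S ((InnerProductSpace.toDual ℂ W).symm
        (WeakDual.toStrongDual φ)))
    simp only [h]
    exact continuous_star.comp (WeakDual.eval_continuous _)
  have := (WeakDual.isCompact_closedBall (𝕜 := ℂ) (E := W) 0 r).image he
  convert! this using 1
  ext z
  constructor
  · rintro ⟨_, ⟨w, hw, rfl⟩, rfl⟩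
    refine ⟨StrongDual.toWeakDual (InnerProductSpace.toDual ℂ W w), ?_, ?_⟩
    · simpa using hw
    · simp [e]
  · rintro ⟨φ, hφ, rfl⟩
    exact ⟨_, ⟨_, by simpa using hφ, rfl⟩, rfl⟩

theorem IsDunfordPettis.isCompactOnCopiesOf {T : X →L[ℂ] Y} (hT : IsDunfordPettis T)
    (W : Type*) [NormedAddCommGroup W] [InnerProductSpace ℂ W] [CompleteSpace W] :
    IsCompactOnCopiesOf W T := by
  rintro E ⟨e⟩
  let S : W →L[ℂ] X := E.subtypeL.comp (e.symm : W →L[ℂ] E)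
  have h : IsCompactOperator (T.comp S) := by
    refine (isCompactOperator_iff_isCompact_closure_image_closedBall
      ((T.comp S : W →L[ℂ] Y) : W →ₗ[ℂ] Y) one_pos).2 ?_
    have := hT _ (isCompact_toWeakSpace_image_closedBall S 1)
    rw [← Set.image_comp] at this
    exact this
  convert! h.comp_clm (e : E →L[ℂ] W) using 1
  ext x
  simp [S]

/-- If `T` is compact on the copies of `ℓ₂`, then so is `T R` for any isometry `R` defined on a
separable Hilbert space. -/
theorem IsCompactOnCopiesOf.comp_linearIsometry {T : X →L[ℂ] Y}
    (hT : IsCompactOnCopiesOf (lp (fun _ : ℕ => ℂ) 2) T) {ι : Type*} [Countable ι]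
    {W : Type*} [NormedAddCommGroup W] [NormedSpace ℂ W] (e : W ≃L[ℂ] lp (fun _ : ι => ℂ) 2)
    (R : W →ₗᵢ[ℂ] X) : IsCompactOperator (T.comp R.toContinuousLinearMap) := by
  cases finite_or_infinite ι
  -- In finite dimension the range of `R` is not a copy of `ℓ₂`, but closed balls of `W` are already
  -- compact.
  · have : Fintype ι := Fintype.ofFinite ι
    have : FiniteDimensional ℂ (lp (fun _ : ι => ℂ) 2) :=
      (lpPiLpₗᵢ (p := 2) (fun _ : ι => ℂ) ℂ).toLinearEquiv.symm.finiteDimensional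
    have : FiniteDimensional ℂ W := e.toLinearEquiv.symm.finiteDimensional
    have : ProperSpace W := FiniteDimensional.proper ℂ W
    exact ⟨_, (isCompact_closedBall (0 : W) 1).image (T.comp R.toContinuousLinearMap).continuous,
      Filter.mem_of_superset (Metric.closedBall_mem_nhds 0 one_pos) (Set.subset_preimage_image _ _)⟩
  · obtain ⟨σ⟩ := nonempty_equiv_of_countable (α := ι) (β := ℕ)
    let b : HilbertBasis ι ℂ (lp (fun _ : ι => ℂ) 2) := ⟨LinearIsometryEquiv.refl ℂ _⟩
    let b' : HilbertBasis ℕ ℂ (lp (fun _ : ι => ℂ) 2) :=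
      HilbertBasis.mk (b.orthonormal.comp _ σ.symm.injective) (by
        rw [σ.symm.surjective.range_comp, b.dense_span])
    have h := hT R.range ⟨(R.equivRange.symm.toContinuousLinearEquiv.trans e).trans
      b'.repr.toContinuousLinearEquiv⟩
    convert! h.comp_clm (R.equivRange.toContinuousLinearEquiv : W →L[ℂ] R.range) using 1

/-- The index set of a Hilbert basis of a separable space is countable. -/
theorem HilbertBasis.countable {H : Type*} [NormedAddCommGroup H] [InnerProductSpace ℂ H]
    [TopologicalSpace.SeparableSpace H] {ι : Type*} (b : HilbertBasis ι ℂ H) : Countable ι := by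
  refine Pairwise.countable_of_isOpen_disjoint (s := fun i => Metric.ball (b i) (1 / 2))
    (fun i j hij => Metric.ball_disjoint_ball ?_) (fun _ => Metric.isOpen_ball)
    fun i => ⟨b i, Metric.mem_ball_self (by norm_num)⟩
  -- Distinct basis vectors are at distance `√2`, more than the sum of the two radii.
  have h := norm_sub_sq (𝕜 := ℂ) (b i) (b j)
  rw [b.orthonormal.2 hij, b.orthonormal.1, b.orthonormal.1] at h
  rw [dist_eq_norm]
  simp only [map_zero] at h
  nlinarith [norm_nonneg (b i - b j)]

theorem isCompactOperator_finsetSum {κ : Type*} (s : Finset κ) {f : κ → X → Y}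
    (hf : ∀ k ∈ s, IsCompactOperator (f k)) : IsCompactOperator fun x => ∑ k ∈ s, f k x := by
  classical
  induction s using Finset.induction_on with
  | empty => exact isCompactOperator_zero
  | insert k s hk ih =>
    simp only [Finset.sum_insert hk]
    exact (hf k (by simp)).add (ih fun i hi => hf i (by simp [hi]))

end WeakTopology

/-! ### Coordinate projections, and smallness of corners on weakly compact sets. -/

namespace SchattenOne

variable {H : Type*} [NormedAddCommGroup H] [InnerProductSpace ℂ H] [CompleteSpace H]
variable {ι : Type*} (b : HilbertBasis ι ℂ H)

/-- The orthogonal projection onto the span of finitely many basis vectors. -/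
def coordProj (F : Finset ι) : H →L[ℂ] H := ∑ i ∈ F, InnerProductSpace.rankOne ℂ (b i) (b i)

theorem coordProj_apply (F : Finset ι) (x : H) :
    coordProj b F x = ∑ i ∈ F, ⟪b i, x⟫_ℂ • b i := by
  simp [coordProj]

theorem coordProj_basis [DecidableEq ι] (F : Finset ι) (j : ι) :
    coordProj b F (b j) = if j ∈ F then b j else 0 := by
  simp [coordProj, orthonormal_iff_ite.1 b.orthonormal, ite_smul]

theorem adjoint_coordProj (F : Finset ι) :
    ContinuousLinearMap.adjoint (coordProj b F) = coordProj b F := by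
  simp [coordProj, map_sum]

theorem adjoint_one_sub_coordProj (F : Finset ι) :
    ContinuousLinearMap.adjoint (1 - coordProj b F) = 1 - coordProj b F := by
  rw [map_sub, adjoint_coordProj, ← ContinuousLinearMap.star_eq_adjoint, star_one]

theorem ext_basis {A B : H →L[ℂ] H} (h : ∀ i, A (b i) = B (b i)) : A = B := by
  refine ContinuousLinearMap.ext_on
    ((Submodule.dense_iff_topologicalClosure_eq_top).2 b.dense_span) ?_
  rintro _ ⟨i, rfl⟩
  exact h i

/-- In the gliding hump, this frees a new block `G` from the coordinates `F` already used. -/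
theorem coordProj_mul_one_sub_coordProj [DecidableEq ι] (F G : Finset ι) :
    coordProj b G * (1 - coordProj b F) = coordProj b (G \ F) := by
  refine ext_basis b fun i => ?_
  simp only [mul_apply_eq_comp, sub_apply, one_apply_eq_self, map_sub, coordProj_basis,
    Finset.mem_sdiff]
  by_cases hF : i ∈ F <;> by_cases hG : i ∈ G <;> simp [hF, hG, coordProj_basis]

theorem one_sub_coordProj_mul_coordProj [DecidableEq ι] (F G : Finset ι) :
    (1 - coordProj b F) * coordProj b G = coordProj b (G \ F) := by
  refine ext_basis b fun i => ?_
  simp only [mul_apply_eq_comp, sub_apply, one_apply_eq_self, coordProj_basis, Finset.mem_sdiff]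
  by_cases hF : i ∈ F <;> by_cases hG : i ∈ G <;> simp [hF, hG, coordProj_basis]

theorem hsSq_mul_coordProj (S : H →L[ℂ] H) (F : Finset ι) :
    hsSq b (S * coordProj b F) = ∑ i ∈ F, ENNReal.ofReal (‖S (b i)‖ ^ 2) := by
  classical
  unfold hsSq
  rw [tsum_eq_sum (s := F)]
  · refine Finset.sum_congr rfl fun i hi => ?_
    simp [coordProj_basis, hi]
  · intro i hi
    simp [coordProj_basis, hi]

theorem hsSq_mul_one_sub_coordProj (S : H →L[ℂ] H) (F : Finset ι) :
    hsSq b (S * (1 - coordProj b F)) =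
      ∑' i : {i // i ∉ F}, ENNReal.ofReal (‖S (b i)‖ ^ 2) := by
  classical
  unfold hsSq
  rw [← tsum_subtype_eq_of_support_subset (s := {i | i ∉ F})]
  · refine tsum_congr fun i => ?_
    have : (i : ι) ∉ F := i.2
    simp [coordProj_basis, this]
  · intro i hi
    by_contra h
    simp only [Set.mem_ofPred_eq, not_not] at h
    simp [coordProj_basis, h] at hi

theorem hsSq_mul_coordProj_le (S : H →L[ℂ] H) (F : Finset ι) :
    hsSq b (S * coordProj b F) ≤ hsSq b S := by
  rw [hsSq_mul_coordProj]
  exact ENNReal.sum_le_tsum F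

theorem tendsto_hsSq_mul_one_sub_coordProj {S : H →L[ℂ] H} (hS : hsSq b S ≠ ∞) :
    Tendsto (fun F => hsSq b (S * (1 - coordProj b F))) atTop (𝓝 0) := by
  simp only [hsSq_mul_one_sub_coordProj]
  exact ENNReal.tendsto_tsum_compl_atTop_zero hS

/-- The block diagonal part of an operator has a smaller trace norm. -/
theorem sum_norm_sandwich_coordProj_le {κ : Type*} {G : κ → Finset ι}
    (hG : Pairwise (Function.onFun Disjoint G)) (A : SchattenOne H) (s : Finset κ) :
    ∑ k ∈ s, ‖sandwich (coordProj b (G k)) (coordProj b (G k)) A‖ ≤ ‖A‖ := by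
  classical
  obtain ⟨S, T, hA, hS, hT⟩ := exists_eq_adjoint_mul b (toOperator A)
  -- The squared Hilbert–Schmidt norm is a sum over basis vectors, hence additive over disjoint
  -- blocks.
  have hsum : ∀ R : H →L[ℂ] H, ∑ k ∈ s, hsSq b (R * coordProj b (G k)) ≤ hsSq b R := by
    intro R
    simp only [hsSq_mul_coordProj]
    rw [← Finset.sum_biUnion fun i _ j _ hij => hG hij]
    exact ENNReal.sum_le_tsum _
  rw [← ENNReal.ofReal_le_ofReal_iff (norm_nonneg _),
    ENNReal.ofReal_sum_of_nonneg fun _ _ => norm_nonneg _]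
  simp only [ofReal_norm, toOperator_sandwich]
  refine (ENNReal.mul_le_mul_iff_right (a := 2) (by simp) (by simp)).1 ?_
  calc 2 * ∑ k ∈ s, eTraceNorm (coordProj b (G k) * toOperator A * coordProj b (G k))
      ≤ ∑ k ∈ s, (hsSq b (S * coordProj b (G k)) + hsSq b (T * coordProj b (G k))) := by
        rw [Finset.mul_sum]
        refine Finset.sum_le_sum fun k _ => ?_
        have h := two_mul_eTraceNorm_adjoint_mul_le b (S * coordProj b (G k))
          (T * coordProj b (G k)) one_pos
        simp only [ENNReal.ofReal_one, inv_one, one_mul] at h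
        refine (le_of_eq ?_).trans h
        rw [← hA, ← ContinuousLinearMap.star_eq_adjoint, ← ContinuousLinearMap.star_eq_adjoint,
          star_mul, ContinuousLinearMap.star_eq_adjoint (coordProj b (G k)), adjoint_coordProj]
        simp only [mul_assoc]
    _ ≤ 2 * eTraceNorm (toOperator A) := by
        rw [Finset.sum_add_distrib, two_mul]
        exact add_le_add ((hsum S).trans hS) ((hsum T).trans hT)

/-- In `A - P A P = (1 - P) A + P A (1 - P)` each term factors with one Hilbert–Schmidt factor cut
down to a tail of the basis, which tends to `0`, while the other stays bounded. -/
theorem tendsto_sandwich_coordProj (A : SchattenOne H) :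
    Tendsto (fun F => sandwich (coordProj b F) (coordProj b F) A) atTop (𝓝 A) := by
  obtain ⟨S, T, hA, hS, hT⟩ := exists_eq_adjoint_mul b (toOperator A)
  have hfin := (eTraceNorm_lt_top A).ne
  rw [Metric.tendsto_nhds]
  intro ε hε
  -- The weight `η` on the bounded factor contributes at most `ε / 2`; a tail below `η * (ε / 4)`
  -- with weight `η⁻¹` contributes `ε / 4`. Half of the total `3 ε / 4` is less than `ε / 2`.
  set η : ℝ := ε / (2 * (‖A‖ + 1)) with hη
  have hη0 : 0 < η := by positivity
  have hηA : η * ‖A‖ ≤ ε / 2 := by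
    rw [hη, div_mul_eq_mul_div, div_le_div_iff₀ (by positivity) (by norm_num)]
    nlinarith [norm_nonneg A]
  have hpos : (0 : ℝ≥0∞) < ENNReal.ofReal (η * (ε / 4)) := by
    rw [ENNReal.ofReal_pos]; positivity
  filter_upwards [(tendsto_hsSq_mul_one_sub_coordProj b
      (ne_top_of_le_ne_top hfin hS)).eventually_le_const hpos,
    (tendsto_hsSq_mul_one_sub_coordProj b
      (ne_top_of_le_ne_top hfin hT)).eventually_le_const hpos] with F hSF hTF
  have bound : ∀ s t : ℝ≥0∞, s ≤ ENNReal.ofReal (η * (ε / 4)) → t ≤ eTraceNorm (toOperator A) →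
      ENNReal.ofReal η⁻¹ * s + ENNReal.ofReal η * t ≤ ENNReal.ofReal (ε * (3 / 4)) := by
    intro s t hs ht
    rw [← ofReal_norm] at ht
    calc ENNReal.ofReal η⁻¹ * s + ENNReal.ofReal η * t
        ≤ ENNReal.ofReal η⁻¹ * ENNReal.ofReal (η * (ε / 4)) +
            ENNReal.ofReal η * ENNReal.ofReal ‖A‖ := by gcongr
      _ = ENNReal.ofReal (ε / 4 + η * ‖A‖) := by
        rw [← ENNReal.ofReal_mul (by positivity), ← ENNReal.ofReal_mul (by positivity),
          ← ENNReal.ofReal_add (by positivity) (by positivity), inv_mul_cancel_left₀ hη0.ne']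
      _ ≤ _ := ENNReal.ofReal_le_ofReal (by linarith)
  have real_bound : ∀ B : SchattenOne H,
      2 * eTraceNorm (toOperator B) ≤ ENNReal.ofReal (ε * (3 / 4)) → ‖B‖ < ε / 2 := by
    intro B hB
    rw [← ofReal_norm, ← ENNReal.ofReal_ofNat, ← ENNReal.ofReal_mul (by norm_num),
      ENNReal.ofReal_le_ofReal_iff (by positivity)] at hB
    linarith
  set P := coordProj b F
  have hP : ContinuousLinearMap.adjoint P = P := adjoint_coordProj b F
  have hQ : ContinuousLinearMap.adjoint (1 - P) = 1 - P := adjoint_one_sub_coordProj b F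
  have h1 : ‖sandwich (1 - P) 1 A‖ < ε / 2 := by
    refine real_bound _ (le_trans (le_of_eq ?_) ((two_mul_eTraceNorm_adjoint_mul_le b
      (S * (1 - P)) T (inv_pos.2 hη0)).trans (by rw [inv_inv]; exact bound _ _ hSF hT)))
    rw [toOperator_sandwich, ← hA, ← ContinuousLinearMap.star_eq_adjoint,
      ← ContinuousLinearMap.star_eq_adjoint, star_mul,
      ContinuousLinearMap.star_eq_adjoint (1 - P), hQ, mul_one, mul_assoc]
  have h2 : ‖sandwich P (1 - P) A‖ < ε / 2 := by
    refine real_bound _ (le_trans (le_of_eq ?_) ((two_mul_eTraceNorm_adjoint_mul_le b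
      (S * P) (T * (1 - P)) hη0).trans (by
        rw [add_comm]; exact bound _ _ hTF ((hsSq_mul_coordProj_le b S F).trans hS))))
    rw [toOperator_sandwich, ← hA, ← ContinuousLinearMap.star_eq_adjoint,
      ← ContinuousLinearMap.star_eq_adjoint, star_mul,
      ContinuousLinearMap.star_eq_adjoint P, hP]
    simp only [mul_assoc]
  have e : A - sandwich P P A = sandwich (1 - P) 1 A + sandwich P (1 - P) A := by
    apply toOperator_injective
    simp only [map_sub, map_add, toOperator_sandwich]
    noncomm_ring
  rw [dist_comm, dist_eq_norm, e]
  exact (norm_add_le _ _).trans_lt (by linarith)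

/-- On a weakly compact set of trace class operators, the compressions to the complement of the
coordinate subspaces are uniformly small. -/
theorem exists_norm_sandwich_one_sub_coordProj_le [Countable ι] {K : Set (SchattenOne H)}
    (hK : IsCompact (toWeakSpace ℂ (SchattenOne H) '' K)) {δ : ℝ} (hδ : 0 < δ) :
    ∃ F : Finset ι, ∀ x ∈ K,
      ‖sandwich (1 - coordProj b F) (1 - coordProj b F) x‖ ≤ δ := by
  classical
  by_contra! hcon
  -- Gliding hump: each new corner avoids all earlier blocks, and its large norm is already seen on
  -- a finite block.
  obtain ⟨f, hf, hdisj⟩ := exists_seq_of_forall_finset_exists'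
    (fun p : Finset ι × SchattenOne H =>
      p.2 ∈ K ∧ δ < ‖sandwich (coordProj b p.1) (coordProj b p.1) p.2‖)
    (Function.onFun Disjoint Prod.fst) (fun s _ => by
      obtain ⟨x, hxK, hx⟩ := hcon (s.biUnion Prod.fst)
      set F := s.biUnion Prod.fst
      set y := sandwich (1 - coordProj b F) (1 - coordProj b F) x
      obtain ⟨G, hG⟩ := ((tendsto_sandwich_coordProj b y).norm.eventually_const_lt hx).exists
      refine ⟨(G \ F, x), ⟨hxK, ?_⟩, fun p hp => ?_⟩
      · refine hG.trans_le (le_of_eq (congrArg norm ?_))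
        apply toOperator_injective
        simp only [y, toOperator_sandwich]
        rw [← mul_assoc, ← mul_assoc, coordProj_mul_one_sub_coordProj, mul_assoc,
          one_sub_coordProj_mul_coordProj]
      · refine Disjoint.symm (Finset.disjoint_of_subset_right
          (Finset.subset_biUnion_of_mem Prod.fst hp) Finset.sdiff_disjoint))
  let G k := (f k).1
  have hG : Pairwise (Function.onFun Disjoint G) := hdisj
  let D k := sandwich (coordProj b (G k)) (coordProj b (G k))
  choose g hg1 hg using fun k => exists_dual_vector'' ℂ (D k (f k).2)
  let Φ k : StrongDual ℂ (SchattenOne H) := (g k).comp (D k)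
  have hΦle : ∀ k x, ‖Φ k x‖ ≤ ‖D k x‖ := fun k x =>
    ((g k).le_of_opNorm_le (hg1 k) _).trans (one_mul _).le
  have hΦ : ∀ x, ∀ s : Finset ℕ, ∑ k ∈ s, ‖Φ k x‖ ≤ 1 * ‖x‖ := fun x s => by
    rw [one_mul]
    exact (Finset.sum_le_sum fun k _ => hΦle k x).trans
      (sum_norm_sandwich_coordProj_le b hG x s)
  have hΦf : ∀ k, δ < ‖Φ k (f k).2‖ := fun k => by
    have : Φ k (f k).2 = (‖D k (f k).2‖ : ℂ) := hg k
    rw [this, Complex.norm_real, norm_norm]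
    exact (hf k).2
  -- The countably many matrix entries separate operators.
  obtain ⟨z, -, φ, hφ, hlim⟩ := exists_subseq_weakly_tendsto hK
    (fun p : ι × ι => ((innerSL ℂ (b p.1)).comp
      (ContinuousLinearMap.apply ℂ H (b p.2))).comp toOperatorL)
    (fun x y hxy => by
      apply toOperator_injective
      refine ext_basis b fun i => b.repr.injective ?_
      ext j
      rw [b.repr_apply_apply, b.repr_apply_apply]
      exact hxy (j, i))
    (fun n => (hf n).1)
  -- The Schur argument needs a weakly null sequence, so the limit `z` is subtracted; its own values
  -- `Φ k z` are summable and tend to `0`. Since `φ` is injective, `φ j` eventually leaves `I`.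
  obtain ⟨N, I, hNI⟩ := exists_forall_notMem_norm_le_of_weakly_tendsto hΦ
    (y := fun j => (f (φ j)).2 - z) (fun u => by
      simpa using (hlim u).sub_const (u z)) (half_pos hδ)
  have hz : Tendsto (fun k => ‖Φ k z‖) cofinite (𝓝 0) :=
    (summable_of_sum_le (fun _ => norm_nonneg _) (hΦ z)).tendsto_cofinite_zero
  have hφI : ∀ᶠ j in atTop, φ j ∉ I :=
    (hφ.injective.tendsto_cofinite.eventually I.eventually_cofinite_notMem).filter_mono
      Nat.cofinite_eq_atTop.ge
  have hφz : ∀ᶠ j in atTop, ‖Φ (φ j) z‖ < δ / 2 :=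
    ((hφ.injective.tendsto_cofinite).eventually (hz.eventually_lt_const (half_pos hδ))).filter_mono
      Nat.cofinite_eq_atTop.ge
  obtain ⟨j, h1, h2, h3⟩ := (hφI.and (hφz.and (eventually_ge_atTop N))).exists
  have h4 := hNI j h3 _ h1
  rw [map_sub] at h4
  have h5 := norm_sub_norm_le (Φ (φ j) (f (φ j)).2) (Φ (φ j) z)
  linarith [hΦf (φ j)]

/-- With `Q = 1 - P`, the difference is `P A + Q A P`: the first term splits into the rows of `A`
indexed by `F`, the second into the columns `Q A bᵢ` for `i ∈ F`. -/
theorem sub_sandwich_one_sub_coordProj (F : Finset ι) (A : SchattenOne H) :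
    A - sandwich (1 - coordProj b F) (1 - coordProj b F) A =
      ∑ i ∈ F, (row (b.orthonormal.1 i) ((innerSL ℂ (b i)).comp (toOperator A)) +
        column (b.orthonormal.1 i) ((1 - coordProj b F) (toOperator A (b i)))) := by
  apply toOperator_injective
  have e : toOperator A - (1 - coordProj b F) * toOperator A * (1 - coordProj b F) =
      coordProj b F * toOperator A + (1 - coordProj b F) * toOperator A * coordProj b F := by
    noncomm_ring
  rw [map_sub, toOperator_sandwich, e, Finset.sum_add_distrib, map_add, map_sum, map_sum]
  simp only [toOperator_row, toOperator_column]
  congr 1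
  · ext x
    simp [coordProj]
  · ext x
    rw [mul_apply_eq_comp, coordProj_apply]
    simp [smul_sub, Finset.sum_sub_distrib]

/-! ### Approximation of `T` by compact operators on a weakly compact set. -/

variable {Z : Type*} [NormedAddCommGroup Z] [NormedSpace ℂ Z]

theorem isCompactOperator_comp_sub_sandwich [Countable ι] {T : SchattenOne H →L[ℂ] Z}
    (hT : IsCompactOnCopiesOf (lp (fun _ : ℕ => ℂ) 2) T) (F : Finset ι) :
    IsCompactOperator (T.comp (ContinuousLinearMap.id ℂ _ -
      sandwich (1 - coordProj b F) (1 - coordProj b F))) := by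
  -- Conjugating the coordinates cancels the conjugate-linearity of the Riesz map.
  let e : StrongDual ℂ H ≃ₗᵢ[ℂ] lp (fun _ : ι => ℂ) 2 :=
    ((InnerProductSpace.toDual ℂ H).symm.trans b.repr).trans (starₗᵢ ℂ)
  have h := isCompactOperator_finsetSum F fun i _ =>
    ((hT.comp_linearIsometry e.toContinuousLinearEquiv (row (b.orthonormal.1 i))).comp_clm
      ((ContinuousLinearMap.compL ℂ H H ℂ (innerSL ℂ (b i))).comp toOperatorL)).add
    ((hT.comp_linearIsometry b.repr.toContinuousLinearEquiv
      (column (b.orthonormal.1 i))).comp_clm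
      ((1 - coordProj b F).comp ((ContinuousLinearMap.apply ℂ H (b i)).comp toOperatorL)))
  convert! h using 1
  ext A
  change T (A - sandwich (1 - coordProj b F) (1 - coordProj b F) A) = _
  rw [sub_sandwich_one_sub_coordProj, map_sum]
  refine Finset.sum_congr rfl fun i _ => ?_
  rw [map_add]
  rfl

/-- For each `ε`, some compact operator `L` is within `ε / 2` of `T` on `K`, so `T '' K` is totally
bounded; completeness of `Z` then gives compactness of its closure. -/
theorem isDunfordPettis_of_isCompactOnCopiesOf [CompleteSpace Z] [Countable ι]
    {T : SchattenOne H →L[ℂ] Z} (b : HilbertBasis ι ℂ H)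
    (hT : IsCompactOnCopiesOf (lp (fun _ : ℕ => ℂ) 2) T) : IsDunfordPettis T := by
  intro K hK
  refine (TotallyBounded.closure ?_).isCompact_of_isClosed isClosed_closure
  rw [Metric.totallyBounded_iff]
  intro ε hε
  obtain ⟨M, -, hM⟩ := exists_norm_le_of_isCompact_toWeakSpace hK
  obtain ⟨F, hF⟩ := exists_norm_sandwich_one_sub_coordProj_le b hK
    -- Chosen so that `‖T‖ * δ ≤ ε / 2`; the `+ 1` covers `T = 0`.
    (δ := ε / (2 * (‖T‖ + 1))) (by positivity)
  set Q := sandwich (1 - coordProj b F) (1 - coordProj b F)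
  set L := T.comp (ContinuousLinearMap.id ℂ _ - Q)
  have hL : IsCompactOperator (L : SchattenOne H →ₗ[ℂ] Z) :=
    isCompactOperator_comp_sub_sandwich b hT F
  obtain ⟨t, ht, hcov⟩ := Metric.totallyBounded_iff.1
    (hL.isCompact_closure_image_closedBall M).totallyBounded (ε / 2) (half_pos hε)
  refine ⟨t, ht, ?_⟩
  rintro _ ⟨x, hx, rfl⟩
  have hmem : L x ∈ closure (L '' Metric.closedBall 0 M) :=
    subset_closure ⟨x, by simpa using hM x hx, rfl⟩
  obtain ⟨y, hy, hxy⟩ := Set.mem_iUnion₂.1 (hcov hmem)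
  refine Set.mem_iUnion₂.2 ⟨y, hy, ?_⟩
  have hd : dist (T x) (L x) ≤ ε / 2 := by
    have : T x - L x = T (Q x) := by simp [L]
    rw [dist_eq_norm, this]
    refine (T.le_opNorm _).trans ?_
    calc ‖T‖ * ‖Q x‖ ≤ (‖T‖ + 1) * (ε / (2 * (‖T‖ + 1))) := by
          gcongr
          · linarith
          · exact hF x hx
      _ = ε / 2 := by field_simp
  exact (dist_triangle _ _ _).trans_lt (by linarith [Metric.mem_ball.1 hxy])

end SchattenOne

end

theorem proposition4p11
    {H : Type*} [NormedAddCommGroup H] [InnerProductSpace ℂ H] [CompleteSpace H]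
    [TopologicalSpace.SeparableSpace H]
    {Z : Type*} [NormedAddCommGroup Z] [NormedSpace ℂ Z] [CompleteSpace Z]
    (T : SchattenOne H →L[ℂ] Z) :
    IsDunfordPettis T ↔ IsCompactOnCopiesOf (lp (fun _ : ℕ => ℂ) 2) T := by
  have := (SchattenOne.basis H).countable
  exact ⟨fun h => h.isCompactOnCopiesOf _,
    SchattenOne.isDunfordPettis_of_isCompactOnCopiesOf (SchattenOne.basis H)⟩
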